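/- Let $G$ be a finite group and let $n$ be a positive integer. Let $D(G)$ be the Drinfel'd double of $G$ over $\mathbb{C}$, that is, the Hopf algebra with basis $p_x\otimes g$ ($x,g\in G$), product $(p_x\otimes g)(p_y\otimes h)=\delta_{x,\,gyg^{-1}}\,p_x\otimes gh$, unit $\sum_{x}p_x\otimes 1$, coproduct $\Delta(p_x\otimes g)=\sum_{ab=x}(p_a\otimes g)\otimes(p_b\otimes g)$, counit $\varepsilon(p_x\otimes g)=\delta_{x,1}$ and antipode $S(p_x\otimes g)=p_{g^{-1}x^{-1}g}\otimes g^{-1}$. Let $\Lambda=|G|^{-1}\sum_{g\in G}p_1\otimes g$ be its normalized integral. For an irreducible representation $V$ of $D(G)$ with character $\chi$, the $n$-th Frobenius–Schur indicator is $\nu_n(V)=\chi(\Lambda^{[n]})$, where $h^{[n]}=h_1h_2\cdots h_n$ in Sweedler notation. The group $G$ is called an $FSZ_n$-group if $\nu_n(V)\in\mathbb{Z}$ for every irreducible representation $V$ of $D(G)$. For $u,g\in G$ put $$G_n(u,g)=\{a\in G \mid (au^{-1})^n=a^n=g\}.$$ Then $G$ is an $FSZ_n$-group if and only if $$|G_n(u,g)|=|G_n(u,g^m)|$$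 for all commuting pairs of elements $u,g\in G$ and all integers $m$ with $\gcd(m,|G|)=1$. -/

import Mathlib

open scoped TensorProduct

universe u

set_option linter.unusedSectionVars false

/-- The Sweedler power `h ↦ h₁ h₂ ⋯ hₙ` of a bialgebra (with `h ↦ ε(h) 1` for `n = 0`). -/
noncomputable def sweedlerPow (R : Type*) (H : Type*) [CommRing R] [Ring H] [Bialgebra R H] :
    ℕ → (H →ₗ[R] H)
  | 0 => Algebra.linearMap R H ∘ₗ Coalgebra.counit
  | n + 1 => LinearMap.mul' R H ∘ₗ
      TensorProduct.map (sweedlerPow R H n) LinearMap.id ∘ₗ Coalgebra.comul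

/-- A normalized two-sided integral of a bialgebra. -/
structure IsNormalizedIntegral (R : Type*) {H : Type*} [CommRing R] [Ring H] [Bialgebra R H]
    (Λ : H) : Prop where
  left : ∀ h : H, h * Λ = Coalgebra.counit (R := R) h • Λ
  right : ∀ h : H, Λ * h = Coalgebra.counit (R := R) h • Λ
  counit_eq_one : Coalgebra.counit (R := R) Λ = 1

/-- The character of an `H`-module `V`: `h ↦ tr(h | V)`. -/
noncomputable def moduleCharacter (R H V : Type*) [CommRing R] [Ring H] [Algebra R H]
    [AddCommGroup V] [Module R V] [Module H V] [IsScalarTower R H V] : H →ₗ[R] R :=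
  LinearMap.trace R V ∘ₗ (Algebra.lsmul R R V : H →ₐ[R] Module.End R V).toLinearMap

/-- The `n`-th Frobenius–Schur indicator `χ_V(Λ^[n])`, computed with the integral `Λ`. -/
noncomputable def fsIndicator (R : Type*) {H : Type*} [CommRing R] [Ring H] [Bialgebra R H]
    (Λ : H) (n : ℕ) (V : Type*) [AddCommGroup V] [Module R V] [Module H V]
    [IsScalarTower R H V] : R :=
  moduleCharacter R H V (sweedlerPow R H n Λ)

/-- The underlying space of the Drinfel'd double `D(G)` over `ℂ`: the function `f` stands for
`∑ x g, f x g • (p_x ⊗ g)`, where `p_x` is the delta function at `x`. -/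
def DrinfeldDouble (G : Type u) : Type u := G → G → ℂ

namespace DrinfeldDouble

variable {G : Type u}

noncomputable instance : AddCommGroup (DrinfeldDouble G) :=
  inferInstanceAs (AddCommGroup (G → G → ℂ))

noncomputable instance : Module ℂ (DrinfeldDouble G) :=
  inferInstanceAs (Module ℂ (G → G → ℂ))

@[ext] theorem ext {f h : DrinfeldDouble G} (H : ∀ x g, f x g = h x g) : f = h :=
  funext fun x => funext fun g => H x g

@[simp] theorem zero_apply (x g : G) : (0 : DrinfeldDouble G) x g = 0 := rfl

@[simp] theorem add_apply (f h : DrinfeldDouble G) (x g : G) : (f + h) x g = f x g + h x g := rfl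

@[simp] theorem smul_apply (c : ℂ) (f : DrinfeldDouble G) (x g : G) :
    (c • f) x g = c * f x g := rfl

/-- Evaluation at `(x, g)` as a linear form. -/
def coeff (x g : G) : DrinfeldDouble G →ₗ[ℂ] ℂ where
  toFun f := f x g
  map_add' _ _ := rfl
  map_smul' _ _ := rfl

theorem sum_apply {ι : Type*} (s : Finset ι) (F : ι → DrinfeldDouble G) (x g : G) :
    (∑ i ∈ s, F i) x g = ∑ i ∈ s, F i x g :=
  map_sum (coeff x g) F s

variable [DecidableEq G]

/-- The basis element `p_x ⊗ g`. -/
def single (x g : G) : DrinfeldDouble G := fun y k => if y = x ∧ k = g then 1 else 0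

theorem single_apply (x g y k : G) :
    single x g y k = if y = x ∧ k = g then (1 : ℂ) else 0 := rfl

variable [Fintype G]

theorem eq_sum_single (f : DrinfeldDouble G) : f = ∑ x, ∑ g, f x g • single x g := by
  ext y k
  simp [sum_apply, single_apply, ite_and]

theorem linearMap_ext {M : Type*} [AddCommMonoid M] [Module ℂ M]
    {φ ψ : DrinfeldDouble G →ₗ[ℂ] M} (h : ∀ x g, φ (single x g) = ψ (single x g)) : φ = ψ := by
  refine LinearMap.ext fun f => ?_
  rw [eq_sum_single f]
  simp [map_sum, h]

variable [Group G]

instance : One (DrinfeldDouble G) := ⟨fun _ g => if g = 1 then 1 else 0⟩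

/-- The product of `D(G)`, determined by
`(p_x ⊗ g) (p_y ⊗ h) = δ_{x, g y g⁻¹} (p_x ⊗ g h)`; see `single_mul_single`. -/
noncomputable instance : Mul (DrinfeldDouble G) :=
  ⟨fun f h x g => ∑ k, f x k * h (k⁻¹ * x * k) (k⁻¹ * g)⟩

theorem one_apply (x g : G) : (1 : DrinfeldDouble G) x g = if g = 1 then 1 else 0 := rfl

theorem mul_apply (f h : DrinfeldDouble G) (x g : G) :
    (f * h) x g = ∑ k, f x k * h (k⁻¹ * x * k) (k⁻¹ * g) := rfl

noncomputable instance : Ring (DrinfeldDouble G) :=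
  { (inferInstance : AddCommGroup (DrinfeldDouble G)),
    (inferInstance : One (DrinfeldDouble G)),
    (inferInstance : Mul (DrinfeldDouble G)) with
    left_distrib := fun a b c => by
      ext x g; simp [mul_apply, mul_add, Finset.sum_add_distrib]
    right_distrib := fun a b c => by
      ext x g; simp [mul_apply, add_mul, Finset.sum_add_distrib]
    zero_mul := fun a => by ext x g; simp [mul_apply]
    mul_zero := fun a => by ext x g; simp [mul_apply]
    one_mul := fun a => by ext x g; simp [mul_apply, one_apply]
    mul_one := fun a => by
      ext x g
      simp only [mul_apply, one_apply, inv_mul_eq_one]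
      simp
    mul_assoc := fun a b c => by
      ext x g
      simp only [mul_apply, Finset.sum_mul, Finset.mul_sum]
      rw [Finset.sum_comm]
      refine Finset.sum_congr rfl fun k _ => ?_
      refine Fintype.sum_equiv (Equiv.mulLeft k⁻¹) _ _ fun l => ?_
      simp [mul_assoc] }

noncomputable instance : Algebra ℂ (DrinfeldDouble G) :=
  Algebra.ofModule
    (fun c f h => by ext x g; simp [mul_apply, Finset.mul_sum, mul_assoc])
    (fun c f h => by ext x g; simp [mul_apply, Finset.mul_sum, mul_left_comm])

theorem single_mul_single (x g y h : G) :
    single x g * single y h = if x = g * y * g⁻¹ then single x (g * h) else 0 := by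
  ext z k
  rw [mul_apply, Finset.sum_eq_single g]
  · by_cases hz : z = x
    · subst hz
      have e1 : (g⁻¹ * z * g = y) ↔ (z = g * y * g⁻¹) := by
        constructor
        · rintro rfl; group
        · rintro rfl; group
      have e2 : (g⁻¹ * k = h) ↔ (k = g * h) := inv_mul_eq_iff_eq_mul
      by_cases h1 : z = g * y * g⁻¹
      · rw [if_pos h1]
        simp [single_apply, e1.2 h1, e2]
      · rw [if_neg h1]
        simp [single_apply, e1, h1]
    · split_ifs <;> simp [single_apply, hz]
  · intro l _ hl
    simp [single_apply, hl]
  · simp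

theorem one_eq_sum : (1 : DrinfeldDouble G) = ∑ x, single x 1 := by
  ext y k
  simp [sum_apply, single_apply, one_apply, ite_and]

/-- The coproduct of `D(G)`, determined by
`Δ(p_x ⊗ g) = ∑_{ab = x} (p_a ⊗ g) ⊗ (p_b ⊗ g)`, and the counit, determined by
`ε(p_x ⊗ g) = δ_{x, 1}`.  (Reversing the two tensor factors of `Δ` gives an isomorphic Hopf algebra,
by `p_x ⊗ g ↦ p_{x⁻¹} ⊗ g`.) -/
noncomputable instance : CoalgebraStruct ℂ (DrinfeldDouble G) where
  comul :=
    { toFun := fun f => ∑ a, ∑ b, ∑ g, f (a * b) g • (single a g ⊗ₜ[ℂ] single b g)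
      map_add' := fun f h => by simp [add_smul, Finset.sum_add_distrib]
      map_smul' := fun c f => by simp [Finset.smul_sum, mul_smul] }
  counit :=
    { toFun := fun f => ∑ g, f 1 g
      map_add' := fun f h => by simp [Finset.sum_add_distrib]
      map_smul' := fun c f => by simp [Finset.mul_sum] }

theorem comul_apply (f : DrinfeldDouble G) :
    CoalgebraStruct.comul (R := ℂ) f =
      ∑ a, ∑ b, ∑ g, f (a * b) g • (single a g ⊗ₜ[ℂ] single b g) := rfl

theorem counit_apply (f : DrinfeldDouble G) :
    CoalgebraStruct.counit (R := ℂ) f = ∑ g, f 1 g := rfl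

theorem comul_single (x g : G) :
    CoalgebraStruct.comul (R := ℂ) (single x g) =
      ∑ a, single a g ⊗ₜ[ℂ] single (a⁻¹ * x) g := by
  rw [comul_apply]
  refine Finset.sum_congr rfl fun a _ => ?_
  rw [Finset.sum_eq_single (a⁻¹ * x)]
  · rw [Finset.sum_eq_single g] <;> simp +contextual [single_apply]
  · intro b _ hb
    refine Finset.sum_eq_zero fun k _ => ?_
    have : a * b ≠ x := fun h => hb (by rw [← h]; group)
    simp [single_apply, this]
  · simp

theorem counit_single (x g : G) :
    CoalgebraStruct.counit (R := ℂ) (single x g) = if x = 1 then 1 else 0 := by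
  by_cases hx : x = 1
  · simp [counit_apply, single_apply, hx]
  · simp [counit_apply, single_apply, hx, Ne.symm hx]

noncomputable instance : Coalgebra ℂ (DrinfeldDouble G) where
  coassoc := by
    refine linearMap_ext fun x g => ?_
    simp only [LinearMap.comp_apply, LinearEquiv.coe_coe, comul_single, map_sum,
      LinearMap.rTensor_tmul, LinearMap.lTensor_tmul, TensorProduct.sum_tmul,
      TensorProduct.tmul_sum, TensorProduct.assoc_tmul]
    rw [Finset.sum_comm]
    refine Finset.sum_congr rfl fun a _ => ?_
    refine Fintype.sum_equiv (Equiv.mulLeft a⁻¹) _ _ fun b => ?_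
    simp [mul_assoc]
  rTensor_counit_comp_comul := by
    refine linearMap_ext fun x g => ?_
    simp only [LinearMap.comp_apply, comul_single, map_sum, LinearMap.rTensor_tmul, counit_single]
    rw [Finset.sum_eq_single 1] <;> simp +contextual
  lTensor_counit_comp_comul := by
    refine linearMap_ext fun x g => ?_
    simp only [LinearMap.comp_apply, comul_single, map_sum, LinearMap.lTensor_tmul, counit_single,
      inv_mul_eq_one]
    rw [Finset.sum_eq_single x] <;> simp +contextual

theorem counit_one' : Coalgebra.counit (R := ℂ) (1 : DrinfeldDouble G) = 1 := by
  simp [counit_apply, one_apply]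

theorem counit_mul' (f h : DrinfeldDouble G) :
    Coalgebra.counit (R := ℂ) (f * h) = Coalgebra.counit f * Coalgebra.counit h := by
  simp only [counit_apply, mul_apply, Finset.sum_mul_sum]
  rw [Finset.sum_comm]
  refine Finset.sum_congr rfl fun k _ => ?_
  refine Fintype.sum_equiv (Equiv.mulLeft k⁻¹) _ _ fun l => ?_
  simp

theorem comul_one' : Coalgebra.comul (R := ℂ) (1 : DrinfeldDouble G) = 1 := by
  rw [Algebra.TensorProduct.one_def, one_eq_sum, map_sum]
  simp only [comul_single, TensorProduct.sum_tmul, TensorProduct.tmul_sum]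
  rw [Finset.sum_comm]
  conv_rhs => rw [Finset.sum_comm]
  refine Finset.sum_congr rfl fun a _ => ?_
  exact Fintype.sum_equiv (Equiv.mulLeft a⁻¹) _ _ fun b => rfl

theorem comul_mul' (f h : DrinfeldDouble G) :
    Coalgebra.comul (R := ℂ) (f * h) = Coalgebra.comul f * Coalgebra.comul h := by
  suffices H : (LinearMap.mul ℂ (DrinfeldDouble G)).compr₂ Coalgebra.comul =
      (LinearMap.mul ℂ (DrinfeldDouble G ⊗[ℂ] DrinfeldDouble G)).compl₁₂
        Coalgebra.comul Coalgebra.comul from LinearMap.congr_fun₂ H f h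
  refine linearMap_ext fun x g => linearMap_ext fun y k => ?_
  simp only [LinearMap.compr₂_apply, LinearMap.compl₁₂_apply, LinearMap.mul_apply',
    single_mul_single, comul_single, Finset.sum_mul, Finset.mul_sum,
    Algebra.TensorProduct.tmul_mul_tmul]
  have inner : ∀ a : G, ∑ b : G,
      ((if a = g * b * g⁻¹ then single a (g * k) else 0) ⊗ₜ[ℂ]
        (if a⁻¹ * x = g * (b⁻¹ * y) * g⁻¹ then single (a⁻¹ * x) (g * k) else 0) :
          DrinfeldDouble G ⊗[ℂ] DrinfeldDouble G) =
      if x = g * y * g⁻¹ then single a (g * k) ⊗ₜ[ℂ] single (a⁻¹ * x) (g * k) else 0 := by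
    intro a
    rw [Finset.sum_eq_single (g⁻¹ * a * g)]
    · have e1 : a = g * (g⁻¹ * a * g) * g⁻¹ := by group
      have e2 : (a⁻¹ * x = g * ((g⁻¹ * a * g)⁻¹ * y) * g⁻¹) ↔ (x = g * y * g⁻¹) := by
        have : g * ((g⁻¹ * a * g)⁻¹ * y) * g⁻¹ = a⁻¹ * (g * y * g⁻¹) := by group
        rw [this, mul_right_inj]
      rw [if_pos e1]
      by_cases h1 : x = g * y * g⁻¹
      · rw [if_pos (e2.2 h1), if_pos h1]
      · rw [if_neg (fun h => h1 (e2.1 h)), if_neg h1, TensorProduct.tmul_zero]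
    · intro b _ hb
      have : a ≠ g * b * g⁻¹ := by rintro rfl; exact hb (by group)
      rw [if_neg this, TensorProduct.zero_tmul]
    · simp
  rw [Finset.sum_comm, Finset.sum_congr rfl fun a _ => inner a]
  split_ifs
  · rw [comul_single]
  · simp

noncomputable instance : Bialgebra ℂ (DrinfeldDouble G) :=
  Bialgebra.mk' ℂ (DrinfeldDouble G) counit_one' (fun {a b} => counit_mul' a b) comul_one'
    (fun {a b} => comul_mul' a b)

/-- The antipode of `D(G)`: `S(p_x ⊗ g) = p_{g⁻¹ x⁻¹ g} ⊗ g⁻¹`; see `antipodeMap_single`. -/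
def antipodeMap : DrinfeldDouble G →ₗ[ℂ] DrinfeldDouble G where
  toFun f := fun y k => f (k⁻¹ * y⁻¹ * k) k⁻¹
  map_add' _ _ := rfl
  map_smul' _ _ := rfl

theorem antipodeMap_single (x g : G) :
    antipodeMap (single x g) = single (g⁻¹ * x⁻¹ * g) g⁻¹ := by
  ext y k
  change (if k⁻¹ * y⁻¹ * k = x ∧ k⁻¹ = g then (1 : ℂ) else 0) =
    if y = g⁻¹ * x⁻¹ * g ∧ k = g⁻¹ then 1 else 0
  congr 1
  refine propext ⟨?_, ?_⟩
  · rintro ⟨rfl, rfl⟩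
    exact ⟨by group, by group⟩
  · rintro ⟨rfl, rfl⟩
    exact ⟨by group, by group⟩

noncomputable instance : HopfAlgebra ℂ (DrinfeldDouble G) where
  antipode := antipodeMap
  mul_antipode_rTensor_comul := by
    refine linearMap_ext fun x g => ?_
    simp only [LinearMap.comp_apply, comul_single, map_sum, LinearMap.rTensor_tmul,
      antipodeMap_single, LinearMap.mul'_apply, single_mul_single, counit_single,
      Algebra.linearMap_apply]
    have e : ∀ a : G, (g⁻¹ * a⁻¹ * g = g⁻¹ * (a⁻¹ * x) * g⁻¹⁻¹) ↔ x = 1 := fun a => by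
      simp [mul_assoc]
    simp only [e]
    split_ifs
    · rw [map_one, one_eq_sum]
      refine Fintype.sum_equiv ((Equiv.inv G).trans (MulAut.conj g⁻¹).toEquiv) _ _ fun a => ?_
      simp
    · simp
  mul_antipode_lTensor_comul := by
    refine linearMap_ext fun x g => ?_
    simp only [LinearMap.comp_apply, comul_single, map_sum, LinearMap.lTensor_tmul,
      antipodeMap_single, LinearMap.mul'_apply, single_mul_single, counit_single,
      Algebra.linearMap_apply]
    have e : ∀ a : G, (a = g * (g⁻¹ * (a⁻¹ * x)⁻¹ * g) * g⁻¹) ↔ x = 1 := fun a => by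
      have : g * (g⁻¹ * (a⁻¹ * x)⁻¹ * g) * g⁻¹ = x⁻¹ * a := by group
      rw [this, eq_comm, mul_eq_right, inv_eq_one]
    simp only [e]
    split_ifs
    · rw [map_one, one_eq_sum]
      simp
    · simp

/-- The normalized integral `|G|⁻¹ ∑_g p_1 ⊗ g` of `D(G)`. -/
noncomputable def integral (G : Type u) [Group G] [Fintype G] [DecidableEq G] : DrinfeldDouble G :=
  (Fintype.card G : ℂ)⁻¹ • ∑ g : G, single 1 g

theorem isNormalizedIntegral_integral : IsNormalizedIntegral ℂ (integral G) where
  left h := by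
    have : LinearMap.mulRight ℂ (integral G) =
        (Coalgebra.counit (R := ℂ) (A := DrinfeldDouble G)).smulRight (integral G) := by
      refine linearMap_ext fun x g => ?_
      simp only [LinearMap.mulRight_apply, LinearMap.smulRight_apply, counit_single, integral,
        mul_smul_comm, Finset.mul_sum, single_mul_single]
      by_cases hx : x = 1
      · subst hx
        simp only [mul_one, mul_inv_cancel, if_true, one_smul]
        congr 1
        exact Fintype.sum_equiv (Equiv.mulLeft g) _ _ fun k => rfl
      · simp [hx]
    exact LinearMap.congr_fun this h
  right h := by
    have : LinearMap.mulLeft ℂ (integral G) =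
        (Coalgebra.counit (R := ℂ) (A := DrinfeldDouble G)).smulRight (integral G) := by
      refine linearMap_ext fun x g => ?_
      simp only [LinearMap.mulLeft_apply, LinearMap.smulRight_apply, counit_single, integral,
        smul_mul_assoc, Finset.sum_mul, single_mul_single]
      have e : ∀ k : G, (1 = k * x * k⁻¹) ↔ x = 1 := fun k => by
        rw [eq_comm, conj_eq_one_iff]
      simp only [e]
      by_cases hx : x = 1
      · subst hx
        simp only [if_true, one_smul]
        congr 1
        exact Fintype.sum_equiv (Equiv.mulRight g) _ _ fun k => rfl
      · simp [hx]
    exact LinearMap.congr_fun this h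
  counit_eq_one := by
    simp [integral, counit_single]

end DrinfeldDouble

/-- The normalized integral is unique. -/
theorem IsNormalizedIntegral.unique {R H : Type*} [CommRing R] [Ring H] [Bialgebra R H]
    {Λ Λ' : H} (h : IsNormalizedIntegral R Λ) (h' : IsNormalizedIntegral R Λ') : Λ = Λ' := by
  have h1 := h.right Λ'
  have h2 := h'.left Λ
  rw [h'.counit_eq_one, one_smul] at h1
  rw [h.counit_eq_one, one_smul] at h2
  exact h1.symm.trans h2

/-- `G` is an `FSZ_n`-group: for every irreducible representation `V` of `D(G)`, the `n`-th
Frobenius–Schur indicator of `V` is a rational integer.  (Every simple `D(G)`-module is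
finite-dimensional and isomorphic to a quotient of `D(G)`, so that the universe of `G` suffices.) -/
def IsFSZ (G : Type u) [Group G] [Fintype G] [DecidableEq G] (n : ℕ) : Prop :=
  ∀ (V : Type u) [AddCommGroup V] [Module ℂ V] [Module (DrinfeldDouble G) V]
    [IsScalarTower ℂ (DrinfeldDouble G) V] [FiniteDimensional ℂ V]
    [IsSimpleModule (DrinfeldDouble G) V],
    ∃ z : ℤ, fsIndicator ℂ (DrinfeldDouble.integral G) n V = (z : ℂ)

/-- The set `G_n(u, g) = {a ∈ G | (a u⁻¹)^n = a^n = g}`. -/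
def nthRootSet {G : Type u} [Group G] (n : ℕ) (u g : G) : Set G :=
  {a : G | (a * u⁻¹) ^ n = a ^ n ∧ a ^ n = g}

/-! Collapsing the Sweedler power of the integral gives `fsIndicator_eq`: the indicator of `V` is
|G|⁻¹ Σ |G_n(a⁻¹,k⁻¹)| χ(p_a ⊗ k). Only commuting pairs contribute, and for them χ(p_a ⊗ k^j), for
`j` prime to |G|, is the Galois conjugate of χ(p_a ⊗ k) under ζ ↦ ζ^j, ζ a primitive |G|-th root of
unity. Since k ↦ k^j is a bijection, conjugating |G|ν_n(V) amounts to replacing the class function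
|G_n(u,g)| by |G_n(u,g^i)|, where i inverts j (`twistedIndicator_eq`).

If the counts are invariant under such powers, |G|ν_n(V) is Galois invariant, hence an integer, so
ν_n(V) is rational. It is also an algebraic integer (`isIntegral_fsIndicator`): it is the trace of
the cyclic rotation of V^{⊗n} cut down to the invariants. Hence it is an integer.

Conversely, if all indicators are integers, the difference of the original and the twisted counts is
a central element of D(G) at which every irreducible character vanishes. By Schur's lemma and
semisimplicity it is zero (`eq_zero_of_forall_moduleCharacter_eq_zero`). -/

/-! ### Traces of operators with a^(N+1) = a, and integral polynomials at roots of unity. -/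

section RootsOfUnity

open Polynomial

/-- The sum of the powers of a nontrivial `N`-th root of unity vanishes. -/
theorem geom_sum_eq_zero_of_pow_eq_one {K : Type*} [Field K] {x : K} {N : ℕ} (hx : x ^ N = 1)
    (h1 : x ≠ 1) : ∑ i ∈ Finset.range N, x ^ i = 0 := by
  rw [geom_sum_eq h1, hx, sub_self, zero_div]

/-- The average of the positive powers of `b` up to the `N`-th one. -/
noncomputable def powAverage {A : Type*} [Ring A] [Algebra ℂ A] (N : ℕ) (b : A) : A :=
  (N : ℂ)⁻¹ • ∑ k ∈ Finset.range N, b ^ (k + 1)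

/-- Multiplication by `b` shifts the exponents 1, …, N, and the last one wraps around. Exponents
start at 1 because `b` need not be invertible. -/
theorem mul_powAverage {A : Type*} [Ring A] [Algebra ℂ A] {N : ℕ} {b : A}
    (hb : b ^ (N + 1) = b) : b * powAverage N b = powAverage N b := by
  have h : ∑ k ∈ Finset.range N, b ^ (k + 1 + 1) = ∑ k ∈ Finset.range N, b ^ (k + 1) := by
    have h1 := Finset.sum_range_succ' (fun k => b ^ (k + 1)) N
    rw [Finset.sum_range_succ, hb] at h1
    simpa using h1.symm
  simp only [powAverage, mul_smul_comm, Finset.mul_sum, ← pow_succ', h]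

theorem isIdempotentElem_powAverage {A : Type*} [Ring A] [Algebra ℂ A] {N : ℕ} (hN : 0 < N)
    {b : A} (hb : b ^ (N + 1) = b) : IsIdempotentElem (powAverage N b) := by
  have h : ∀ k, b ^ k * powAverage N b = powAverage N b := by
    intro k
    induction k with
    | zero => simp
    | succ k ih => rw [pow_succ, mul_assoc, mul_powAverage hb, ih]
  have hN' : (N : ℂ) ≠ 0 := by exact_mod_cast hN.ne'
  unfold IsIdempotentElem
  conv_lhs => lhs; rw [powAverage]
  rw [smul_mul_assoc, Finset.sum_mul, Finset.sum_congr rfl fun k _ => h (k + 1)]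
  simp [← Nat.cast_smul_eq_nsmul ℂ, smul_smul, hN']

/-- Spectral decomposition of an element `a` with `a ^ (N + 1) = a`. -/
theorem pow_eq_sum_powAverage {A : Type*} [Ring A] [Algebra ℂ A] {N : ℕ} (hN : 0 < N)
    {a : A} (ha : a ^ (N + 1) = a) {ζ : ℂ} (hζ : IsPrimitiveRoot ζ N) (j : ℕ) :
    a ^ (j + 1) = ∑ i ∈ Finset.range N, (ζ ^ i) ^ (j + 1) • powAverage N ((ζ ^ i)⁻¹ • a) := by
  have hN' : (N : ℂ) ≠ 0 := by exact_mod_cast hN.ne'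
  have hζ0 : ζ ≠ 0 := hζ.ne_zero hN.ne'
  -- The averages are the projections onto the ζ^i-eigenspaces of `a`; the kernel of `a` is missed,
  -- so only positive powers are recovered.
  have key : ∀ i, a * powAverage N ((ζ ^ i)⁻¹ • a) = ζ ^ i • powAverage N ((ζ ^ i)⁻¹ • a) := by
    intro i
    have hw : ((ζ ^ i)⁻¹) ^ N = 1 := by
      rw [inv_pow, ← pow_mul, mul_comm, pow_mul, hζ.pow_eq_one, one_pow, inv_one]
    have hb : ((ζ ^ i)⁻¹ • a) ^ (N + 1) = (ζ ^ i)⁻¹ • a := by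
      rw [_root_.smul_pow, ha, pow_succ, hw, one_mul]
    conv_rhs => rw [← mul_powAverage hb]
    rw [smul_mul_assoc, smul_smul, mul_inv_cancel₀ (pow_ne_zero _ hζ0), one_smul]
  induction j with
  | zero =>
    simp only [zero_add, pow_one, powAverage, _root_.smul_pow, Finset.smul_sum, smul_smul]
    rw [Finset.sum_comm]
    -- Orthogonality of roots of unity: only the first power of `a` survives the sum over `i`.
    have inner : ∀ k ∈ Finset.range N,
        ∑ i ∈ Finset.range N, (ζ ^ i * ((N : ℂ)⁻¹ * ((ζ ^ i)⁻¹) ^ (k + 1))) • a ^ (k + 1) =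
          if k = 0 then a else 0 := by
      intro k hk
      have hs : ∀ i, ζ ^ i * ((N : ℂ)⁻¹ * ((ζ ^ i)⁻¹) ^ (k + 1)) =
          (N : ℂ)⁻¹ * ((ζ ^ k)⁻¹) ^ i := by
        intro i
        have h1 : ((ζ ^ k)⁻¹) ^ i = ((ζ ^ i)⁻¹) ^ k := by
          rw [inv_pow, inv_pow, ← pow_mul, ← pow_mul, mul_comm]
        rw [h1, pow_succ]
        field_simp
      simp only [hs]
      rw [← Finset.sum_smul, ← Finset.mul_sum]
      split_ifs with h0
      · subst h0; simp [hN']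
      · rw [geom_sum_eq_zero_of_pow_eq_one]
        · simp
        · rw [inv_pow, ← pow_mul, mul_comm, pow_mul, hζ.pow_eq_one, one_pow, inv_one]
        · rw [Ne, inv_eq_one]
          exact hζ.pow_ne_one_of_pos_of_lt h0 (Finset.mem_range.1 hk)
    rw [Finset.sum_congr rfl inner]
    simp [hN.ne']
  | succ j ih =>
    rw [pow_succ' a (j + 1), ih, Finset.mul_sum]
    refine Finset.sum_congr rfl fun i _ => ?_
    rw [mul_smul_comm, key, smul_smul, ← pow_succ]

theorem exists_nat_trace_eq_of_isIdempotentElem {V : Type*} [AddCommGroup V] [Module ℂ V]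
    [FiniteDimensional ℂ V] {e : Module.End ℂ V} (he : IsIdempotentElem e) :
    ∃ r : ℕ, LinearMap.trace ℂ V e = r :=
  ⟨_, (LinearMap.isProj_range_iff_isIdempotentElem e |>.2 he).trace⟩

/-- The traces of the powers of an operator `a` with `a ^ (N + 1) = a` are the values of an integral
polynomial at the powers of a primitive `N`-th root of unity. -/
theorem exists_polynomial_trace_pow {V : Type*} [AddCommGroup V] [Module ℂ V]
    [FiniteDimensional ℂ V] {N : ℕ} (hN : 0 < N) {a : Module.End ℂ V} (ha : a ^ (N + 1) = a)
    {ζ : ℂ} (hζ : IsPrimitiveRoot ζ N) :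
    ∃ Q : ℤ[X], ∀ j : ℕ, 0 < j → LinearMap.trace ℂ V (a ^ j) = aeval (ζ ^ j) Q := by
  have hr : ∀ i : ℕ, ∃ r : ℕ, LinearMap.trace ℂ V (powAverage N ((ζ ^ i)⁻¹ • a)) = r := by
    intro i
    refine exists_nat_trace_eq_of_isIdempotentElem (isIdempotentElem_powAverage hN ?_)
    rw [_root_.smul_pow, ha, pow_succ, inv_pow, ← pow_mul, mul_comm i, pow_mul, hζ.pow_eq_one, one_pow,
      inv_one, one_mul]
  choose r hr using hr
  refine ⟨∑ i ∈ Finset.range N, C (r i : ℤ) * X ^ i, fun j hj => ?_⟩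
  obtain ⟨j, rfl⟩ := Nat.exists_eq_add_of_le' hj
  rw [pow_eq_sum_powAverage hN ha hζ]
  simp only [map_sum, map_smul, hr, map_mul, aeval_C, map_pow, aeval_X]
  refine Finset.sum_congr rfl fun i _ => ?_
  rw [← pow_mul, ← pow_mul, mul_comm i]
  simp [mul_comm]

theorem isIntegral_trace_of_pow_succ_eq_self {V : Type*} [AddCommGroup V] [Module ℂ V]
    [FiniteDimensional ℂ V] {N : ℕ} (hN : 0 < N) {a : Module.End ℂ V} (ha : a ^ (N + 1) = a) :
    IsIntegral ℤ (LinearMap.trace ℂ V a) := by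
  have hζ := Complex.isPrimitiveRoot_exp N hN.ne'
  obtain ⟨Q, hQ⟩ := exists_polynomial_trace_pow hN ha hζ
  have h1 := hQ 1 one_pos
  rw [pow_one, pow_one] at h1
  rw [h1]
  exact (IsIntegral.of_mem_of_fg _ (IsIntegral.fg_adjoin_singleton (hζ.isIntegral hN)) _
    (aeval_mem_adjoin_singleton ℤ _))

/-- An integral polynomial with an integral value at a primitive root of unity has the same value
at all conjugates. -/
theorem aeval_pow_eq_of_aeval_eq_intCast {N : ℕ} (hN : 0 < N) {ζ : ℂ} (hζ : IsPrimitiveRoot ζ N)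
    {P : ℤ[X]} {c : ℤ} (hc : aeval ζ P = c) {j : ℕ} (hj : j.Coprime N) :
    aeval (ζ ^ j) P = c := by
  have h0 : aeval ζ (P - C c) = 0 := by simp [hc]
  -- ζ and ζ^j share their minimal polynomial over ℤ, which divides P − c.
  have hd := minpoly.isIntegrallyClosed_dvd (hζ.isIntegral hN) h0
  rw [hζ.minpoly_eq_pow_coprime hj] at hd
  obtain ⟨q, hq⟩ := hd
  have h1 : aeval (ζ ^ j) (P - C c) = 0 := by rw [hq]; simp
  simpa [sub_eq_zero] using h1

/-- An integral polynomial whose values at all primitive `N`-th roots of unity agree has an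
integral value there. -/
theorem exists_int_aeval_eq_of_forall_pow {N : ℕ} (hN : 0 < N) {ζ : ℂ}
    (hζ : IsPrimitiveRoot ζ N) {P : ℤ[X]}
    (h : ∀ j : ℕ, 0 < j → j.Coprime N → aeval (ζ ^ j) P = aeval ζ P) :
    ∃ c : ℤ, aeval ζ P = c := by
  -- The remainder has degree below φ(N) but takes one value at φ(N) points, so it is constant.
  set R := P %ₘ cyclotomic N ℤ with hR
  have hroot : ∀ ξ : ℂ, IsPrimitiveRoot ξ N → aeval ξ R = aeval ζ P := by
    intro ξ hξ
    have hc : aeval ξ (cyclotomic N ℤ) = 0 := by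
      rw [cyclotomic_eq_minpoly hξ hN, minpoly.aeval]
    have h1 : aeval ξ R = aeval ξ P := by
      conv_rhs => rw [← modByMonic_add_div P (cyclotomic N ℤ)]
      rw [map_add, map_mul, hc, zero_mul, add_zero]
    have : NeZero N := ⟨hN.ne'⟩
    obtain ⟨i, -, hi, rfl⟩ := (hζ.isPrimitiveRoot_iff).1 hξ
    rw [h1]
    -- The shift by `N` keeps the exponent positive: `i` can be 0 when N = 1.
    have h2 := h (i + N) (by omega) (by simpa using hi)
    rwa [pow_add, hζ.pow_eq_one, mul_one] at h2
  have hz : R.map (Int.castRingHom ℂ) - C (aeval ζ P) = 0 := by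
    by_contra hne
    have hsub : primitiveRoots N ℂ ⊆
        (R.map (Int.castRingHom ℂ) - C (aeval ζ P)).roots.toFinset := by
      intro ξ hξ
      rw [Multiset.mem_toFinset, mem_roots hne, IsRoot, eval_sub, eval_C, eval_map, sub_eq_zero]
      exact hroot ξ ((mem_primitiveRoots hN).1 hξ)
    have h1 := (Finset.card_le_card hsub).trans
      ((Multiset.toFinset_card_le _).trans (card_roots' _))
    rw [hζ.card_primitiveRoots] at h1
    have h2 : (R.map (Int.castRingHom ℂ) - C (aeval ζ P)).natDegree < N.totient := by
      rw [natDegree_sub_C]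
      refine natDegree_map_le.trans_lt ?_
      have hne1 : cyclotomic N ℤ ≠ 1 := by
        intro h1
        have := congrArg natDegree h1
        rw [natDegree_cyclotomic, natDegree_one] at this
        exact (Nat.totient_pos.2 hN).ne' this
      exact (natDegree_modByMonic_lt P (cyclotomic.monic N ℤ) hne1).trans_eq
        (natDegree_cyclotomic N ℤ)
    omega
  refine ⟨R.coeff 0, ?_⟩
  have := congrArg (fun p => coeff p 0) (sub_eq_zero.1 hz)
  simpa using this.symm

end RootsOfUnity

/-! ### Tensor powers of matrices and the cyclic rotation of their factors. -/

section KroneckerPower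

open Matrix

variable {ι R : Type*} [Fintype ι] [DecidableEq ι] [CommRing R] {n : ℕ}

/-- The matrix of the tensor product of a finite family of operators on the same free module. -/
def piKronecker (M : Fin n → Matrix ι ι R) : Matrix (Fin n → ι) (Fin n → ι) R :=
  Matrix.of fun I J => ∏ k, M k (I k) (J k)

theorem piKronecker_mul (M M' : Fin n → Matrix ι ι R) :
    piKronecker M * piKronecker M' = piKronecker (fun k => M k * M' k) := by
  ext I J
  simp only [piKronecker, Matrix.mul_apply, Matrix.of_apply, ← Finset.prod_mul_distrib]
  exact (Fintype.prod_sum fun k l => M k (I k) l * M' k l (J k)).symm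

theorem piKronecker_eq_zero {M : Fin n → Matrix ι ι R} {k : Fin n} (hk : M k = 0) :
    piKronecker M = 0 := by
  ext I J
  exact Finset.prod_eq_zero (Finset.mem_univ k) (by simp [hk])

variable (ι R n) in
/-- The matrix of the cyclic rotation of the factors of a tensor power. -/
def rotationMatrix : Matrix (Fin n → ι) (Fin n → ι) R :=
  (Equiv.toPEquiv (Equiv.arrowCongr (finRotate n) (Equiv.refl ι))).toMatrix

theorem rotationMatrix_mul (M : Matrix (Fin n → ι) (Fin n → ι) R) (I J : Fin n → ι) :
    (rotationMatrix ι R n * M) I J = M (I ∘ (finRotate n).symm) J := by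
  rw [rotationMatrix, PEquiv.toMatrix_toPEquiv_mul]
  rfl

theorem mul_rotationMatrix (M : Matrix (Fin n → ι) (Fin n → ι) R) (I J : Fin n → ι) :
    (M * rotationMatrix ι R n) I J = M I (J ∘ finRotate n) := by
  rw [rotationMatrix, PEquiv.mul_toMatrix_toPEquiv]
  rfl

theorem rotationMatrix_mul_piKronecker (M : Fin n → Matrix ι ι R) :
    rotationMatrix ι R n * piKronecker M =
      piKronecker (M ∘ finRotate n) * rotationMatrix ι R n := by
  ext I J
  rw [rotationMatrix_mul, mul_rotationMatrix]
  simp only [piKronecker, Matrix.of_apply, Function.comp_apply]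
  exact Fintype.prod_equiv (finRotate n).symm _ _ fun k => by
    rw [Equiv.apply_symm_apply]

theorem finRotate_iterate_self (n : ℕ) : (finRotate n)^[n] = id := by
  cases n with
  | zero => rfl
  | succ m =>
    have h : ∀ (j : ℕ) (i : Fin (m + 1)),
        ((finRotate (m + 1))^[j] i : ℕ) = (i + j) % (m + 1) := by
      intro j
      induction j with
      | zero => intro i; simp [Nat.mod_eq_of_lt i.isLt]
      | succ j ih =>
        intro i
        rw [Function.iterate_succ_apply', finRotate_apply, Fin.val_add, ih, show ((1 : Fin (m + 1)) : ℕ) = 1 % (m + 1) from rfl,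
          ← Nat.add_mod, add_assoc]
    ext i
    rw [h, Nat.add_mod_right, Nat.mod_eq_of_lt i.isLt, id]

theorem rotationMatrix_pow_self : rotationMatrix ι R n ^ n = 1 := by
  have h : ∀ j : ℕ, ∀ I J : Fin n → ι, (rotationMatrix ι R n ^ j) I J =
      (1 : Matrix (Fin n → ι) (Fin n → ι) R) I (J ∘ (finRotate n)^[j]) := by
    intro j
    induction j with
    | zero => intro I J; rfl
    | succ j ih =>
      intro I J
      rw [pow_succ, mul_rotationMatrix, ih, Function.comp_assoc, ← Function.iterate_succ']
  ext I J
  rw [h, finRotate_iterate_self, Function.comp_id]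

/-- Expansion of an entry of a product of matrices as a sum over paths. -/
theorem list_ofFn_prod_apply (m : ℕ) (M : Fin (m + 1) → Matrix ι ι R) (i j : ι) :
    (List.ofFn M).prod i j =
      ∑ I : Fin m → ι, ∏ k, M k (Fin.cons (α := fun _ => ι) i I k)
        (Fin.snoc (α := fun _ => ι) I j k) := by
  induction m generalizing i with
  | zero => simp [Fin.snoc]
  | succ m ih =>
    rw [List.ofFn_succ, List.prod_cons, Matrix.mul_apply]
    rw [← (Fin.consEquiv fun _ => ι).sum_comp, Fintype.sum_prod_type]
    refine Finset.sum_congr rfl fun l _ => ?_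
    rw [ih, Finset.mul_sum]
    refine Finset.sum_congr rfl fun I _ => ?_
    rw [Fin.prod_univ_succ (n := m + 1)]
    change _ = M 0 i (Fin.snoc (α := fun _ => ι) (Fin.cons (α := fun _ => ι) l I) j 0) * _
    have h : (Fin.consEquiv fun _ => ι) (l, I) = Fin.cons (α := fun _ => ι) l I := rfl
    rw [h, ← Fin.cons_snoc_eq_snoc_cons (β := ι)]
    simp only [Fin.cons_zero, Fin.cons_succ]

/-- A closed path based at `i` is a cyclic sequence, so its list of end points is the rotation of
its list of starting points. For n = 0 the two sides would be |ι| and 1. -/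
theorem trace_list_ofFn_prod (hn : 0 < n) (M : Fin n → Matrix ι ι R) :
    (List.ofFn M).prod.trace = ∑ I : Fin n → ι, ∏ k, M k (I k) (I (finRotate n k)) := by
  obtain ⟨m, rfl⟩ := Nat.exists_eq_add_of_le' hn
  rw [Matrix.trace, ← (Fin.consEquiv fun _ => ι).sum_comp, Fintype.sum_prod_type]
  refine Finset.sum_congr rfl fun i _ => ?_
  rw [Matrix.diag_apply, list_ofFn_prod_apply]
  simp only [Fin.snoc_eq_cons_rotate, Fin.consEquiv_apply]

/-- This turns the trace of a product in the algebra into a trace on the tensor power, where finite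
order can be exploited. -/
theorem trace_piKronecker_mul_rotationMatrix (hn : 0 < n) (M : Fin n → Matrix ι ι R) :
    (piKronecker M * rotationMatrix ι R n).trace = (List.ofFn M).prod.trace := by
  rw [trace_list_ofFn_prod hn, Matrix.trace]
  simp [Matrix.diag_apply, mul_rotationMatrix, piKronecker]

end KroneckerPower

/-! ### Sweedler powers and the formula for the indicator. -/

namespace DrinfeldDouble

variable {G : Type u} [Group G] [Fintype G] [DecidableEq G]

theorem sweedlerPow_succ_single (n : ℕ) (x g : G) :
    sweedlerPow ℂ (DrinfeldDouble G) (n + 1) (single x g) =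
      ∑ a, sweedlerPow ℂ (DrinfeldDouble G) n (single a g) * single (a⁻¹ * x) g := by
  rw [sweedlerPow, LinearMap.comp_apply, LinearMap.comp_apply]
  rw [show Coalgebra.comul (R := ℂ) (single x g) = _ from comul_single x g]
  simp

theorem sweedlerPow_zero_single (x g : G) :
    sweedlerPow ℂ (DrinfeldDouble G) 0 (single x g) = if x = 1 then 1 else 0 := by
  rw [sweedlerPow, LinearMap.comp_apply,
    show Coalgebra.counit (R := ℂ) (single x g) = _ from counit_single x g]
  split_ifs <;> simp

/-- A product of factors p_{a_i} ⊗ g is nonzero only if a_{i+1} = g⁻¹ a_i g; the labels then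
multiply to (a g⁻¹)^n g^n, where a = a_1. -/
theorem sweedlerPow_single (n : ℕ) (x g : G) :
    sweedlerPow ℂ (DrinfeldDouble G) n (single x g) =
      ∑ a, if (a * g⁻¹) ^ n * g ^ n = x then single a (g ^ n) else 0 := by
  induction n generalizing x with
  | zero =>
    rw [sweedlerPow_zero_single, one_eq_sum]
    by_cases hx : x = 1
    · simp [hx]
    · simp [hx, Ne.symm hx]
  | succ n ih =>
    rw [sweedlerPow_succ_single]
    simp only [ih, Finset.sum_mul, ite_mul, zero_mul]
    rw [Finset.sum_comm]
    refine Finset.sum_congr rfl fun a _ => ?_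
    rw [Finset.sum_ite_eq, if_pos (Finset.mem_univ _), single_mul_single, ← pow_succ]
    congr 1
    refine propext ?_
    have h : g ^ n * (((a * g⁻¹) ^ n * g ^ n)⁻¹ * x) * (g ^ n)⁻¹ =
        ((a * g⁻¹) ^ n)⁻¹ * x * (g ^ n)⁻¹ := by group
    rw [h, eq_mul_inv_iff_mul_eq, eq_inv_mul_iff_mul_eq, pow_succ, pow_succ']
    simp only [mul_assoc, inv_mul_cancel_left]

/-- The uncollapsed form, to be matched term by term with the action on the tensor power. -/
theorem sweedlerPow_single_eq_sum_list (n : ℕ) (x g : G) :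
    sweedlerPow ℂ (DrinfeldDouble G) n (single x g) =
      ∑ a : Fin n → G, if (List.ofFn a).prod = x then
        (List.ofFn fun k => single (a k) g).prod else 0 := by
  induction n generalizing x with
  | zero => simp [sweedlerPow_zero_single, eq_comm]
  | succ n ih =>
    rw [sweedlerPow_succ_single, ← (Fin.snocEquiv fun _ => G).sum_comp, Fintype.sum_prod_type]
    have h1 : ∀ (c : G) (a : Fin n → G),
        (Fin.snocEquiv fun _ => G) (c, a) = Fin.snoc (α := fun _ => G) a c := fun _ _ => rfl
    simp only [h1, ih, Finset.sum_mul, ite_mul, zero_mul, List.ofFn_succ', Fin.snoc_castSucc,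
      Fin.snoc_last, List.concat_eq_append, List.prod_append, List.prod_singleton]
    rw [Finset.sum_comm]
    conv_rhs => rw [Finset.sum_comm]
    refine Finset.sum_congr rfl fun a _ => ?_
    rw [Finset.sum_ite_eq, if_pos (Finset.mem_univ _)]
    simp only [← eq_inv_mul_iff_mul_eq]
    rw [Finset.sum_ite_eq', if_pos (Finset.mem_univ _)]

/-- If `g` is an n-th power of both a and a u⁻¹, it commutes with both, hence with `u`. -/
theorem nthRootSet_eq_empty_of_not_commute {n : ℕ} {u g : G} (h : ¬ Commute u g) :
    nthRootSet n u g = ∅ := by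
  refine Set.eq_empty_iff_forall_notMem.2 fun a ⟨h1, h2⟩ => h ?_
  have c1 : Commute a g := h2 ▸ (Commute.refl a).pow_right n
  have c2 : Commute (a * u⁻¹) g := by
    rw [← h2, ← h1]
    exact (Commute.refl _).pow_right n
  have c3 : Commute (a⁻¹ * (a * u⁻¹)) g := c1.inv_left.mul_left c2
  rw [inv_mul_cancel_left] at c3
  simpa using c3.inv_left

theorem ncard_nthRootSet_conj (n : ℕ) (u g h : G) :
    (nthRootSet n (h * u * h⁻¹) (h * g * h⁻¹)).ncard = (nthRootSet n u g).ncard := by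
  have : nthRootSet n (h * u * h⁻¹) (h * g * h⁻¹) = MulAut.conj h '' nthRootSet n u g := by
    ext a
    obtain ⟨b, rfl⟩ := (MulAut.conj h).surjective a
    have h1 : h * g * h⁻¹ = MulAut.conj h g := rfl
    have h2 : MulAut.conj h b * (h * u * h⁻¹)⁻¹ = MulAut.conj h (b * u⁻¹) := by
      rw [map_mul, map_inv]; rfl
    rw [(MulAut.conj h).injective.mem_set_image]
    simp only [nthRootSet, Set.mem_ofPred_eq]
    rw [h1, h2, ← map_pow, ← map_pow,
      (MulAut.conj h).injective.eq_iff, (MulAut.conj h).injective.eq_iff]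
  rw [this, Set.ncard_image_of_injective _ (MulAut.conj h).injective]

theorem sweedlerPow_integral (n : ℕ) :
    sweedlerPow ℂ (DrinfeldDouble G) n (integral G) =
      (Fintype.card G : ℂ)⁻¹ • ∑ b : G, ∑ a : G,
        if (a * b) ^ n = b ^ n then single a (b ^ n)⁻¹ else 0 := by
  rw [integral, map_smul, map_sum]
  congr 1
  refine Fintype.sum_equiv (Equiv.inv G) _ _ fun g => ?_
  rw [sweedlerPow_single]
  refine Finset.sum_congr rfl fun a _ => ?_
  simp [mul_eq_one_iff_eq_inv]

section Character

variable (V : Type*) [AddCommGroup V] [Module ℂ V] [Module (DrinfeldDouble G) V]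
  [IsScalarTower ℂ (DrinfeldDouble G) V]

theorem moduleCharacter_mul_comm (f h : DrinfeldDouble G) :
    moduleCharacter ℂ (DrinfeldDouble G) V (f * h) =
      moduleCharacter ℂ (DrinfeldDouble G) V (h * f) := by
  simp only [moduleCharacter, LinearMap.comp_apply, AlgHom.toLinearMap_apply, map_mul]
  exact LinearMap.trace_mul_comm _ _ _

/-- Split off the idempotent p_a ⊗ 1 on the left; by cyclicity of the trace it may be moved to the
right, where it kills the element. -/
theorem moduleCharacter_single_eq_zero {a k : G} (h : ¬ Commute a k) :
    moduleCharacter ℂ (DrinfeldDouble G) V (single a k) = 0 := by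
  have h1 : single a k = single a 1 * single a k := by simp [single_mul_single]
  have h2 : single a k * single a 1 = 0 := by
    rw [single_mul_single, if_neg]
    intro h'
    rw [eq_mul_inv_iff_mul_eq] at h'
    exact h h'
  rw [h1, moduleCharacter_mul_comm, h2, map_zero]

theorem fsIndicator_eq (n : ℕ) :
    fsIndicator ℂ (integral G) n V = (Fintype.card G : ℂ)⁻¹ * ∑ a : G, ∑ k : G,
      ((nthRootSet n a⁻¹ k⁻¹).ncard : ℂ) * moduleCharacter ℂ (DrinfeldDouble G) V (single a k) := by
  classical
  rw [fsIndicator, sweedlerPow_integral, map_smul, smul_eq_mul, map_sum]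
  congr 1
  simp only [map_sum]
  rw [Finset.sum_comm]
  refine Finset.sum_congr rfl fun a _ => ?_
  have h1 : ∀ b : G, moduleCharacter ℂ (DrinfeldDouble G) V
      (if (a * b) ^ n = b ^ n then single a (b ^ n)⁻¹ else 0) =
      ∑ k : G, if b ∈ nthRootSet n a⁻¹ k⁻¹ then
        moduleCharacter ℂ (DrinfeldDouble G) V (single a k) else 0 := by
    intro b
    -- The Sweedler power gives (ab)^n = b^n but the root set asks for (ba)^n = b^n; they agree when
    -- a commutes with b^n, and otherwise the character is zero.
    have hconj : (b * a) ^ n = a⁻¹ * (a * b) ^ n * a := by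
      have := conj_pow (i := n) (a := a⁻¹) (b := a * b)
      rw [inv_inv] at this
      rw [← this]
      simp
    rw [Finset.sum_eq_single (b ^ n)⁻¹]
    · by_cases hc : Commute a (b ^ n)⁻¹
      · have hc' : Commute a (b ^ n) := by simpa using hc.inv_right
        have : b ∈ nthRootSet n a⁻¹ (b ^ n)⁻¹⁻¹ ↔ (a * b) ^ n = b ^ n := by
          simp only [nthRootSet, Set.mem_ofPred_eq, inv_inv, and_true, hconj]
          rw [mul_assoc, inv_mul_eq_iff_eq_mul, hc'.eq, mul_left_inj]
        simp only [this]
        split_ifs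
        · rfl
        · exact map_zero _
      · rw [moduleCharacter_single_eq_zero V hc]
        simp [apply_ite, moduleCharacter_single_eq_zero V hc]
    · intro k _ hk
      rw [if_neg]
      rintro ⟨-, h2⟩
      exact hk (by rw [h2, inv_inv])
    · simp
  simp only [h1]
  rw [Finset.sum_comm]
  refine Finset.sum_congr rfl fun k _ => ?_
  rw [← Finset.sum_filter, Finset.sum_const, nsmul_eq_mul, Set.ncard_eq_toFinset_card']
  congr 3
  ext b
  simp

end Character

end DrinfeldDouble

/-! ### Invariants of tensor powers and integrality of the indicators. -/

theorem prod_list_ofFn_comp_finRotate_eq_one_iff {G : Type*} [Group G] {n : ℕ} (a : Fin n → G) :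
    (List.ofFn (a ∘ finRotate n)).prod = 1 ↔ (List.ofFn a).prod = 1 := by
  cases n with
  | zero => simp
  | succ m =>
    obtain ⟨⟨c, t⟩, rfl⟩ := (Fin.consEquiv fun _ => G).surjective a
    have h1 : (Fin.consEquiv fun _ => G) (c, t) = Fin.cons (α := fun _ => G) c t := rfl
    have h2 : (Fin.cons (α := fun _ => G) c t) ∘ finRotate (m + 1) =
        Fin.snoc (α := fun _ => G) t c := (Fin.snoc_eq_cons_rotate t c).symm
    rw [h1, h2, List.ofFn_succ', List.ofFn_succ]
    simp only [Fin.snoc_castSucc, Fin.snoc_last, Fin.cons_zero, Fin.cons_succ,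
      List.concat_eq_append, List.prod_append, List.prod_cons, List.prod_nil, mul_one]
    rw [mul_eq_one_iff_eq_inv, mul_eq_one_iff_inv_eq, eq_comm]

namespace DrinfeldDouble

variable {G : Type u} [Group G] [Fintype G] [DecidableEq G]
  {ι : Type*} [Fintype ι] [DecidableEq ι]

/-- The action of `g` on the part of degree `1` of the `n`-th tensor power of the representation
`ρ` of `D(G)`, extended by zero to the other degrees. -/
noncomputable def tensorPowAction (ρ : DrinfeldDouble G →ₐ[ℂ] Matrix ι ι ℂ) (n : ℕ) (g : G) :
    Matrix (Fin n → ι) (Fin n → ι) ℂ :=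
  ∑ a : Fin n → G, if (List.ofFn a).prod = 1 then
    piKronecker (fun k => ρ (single (a k) g)) else 0

theorem tensorPowAction_mul (ρ : DrinfeldDouble G →ₐ[ℂ] Matrix ι ι ℂ) (n : ℕ) (g h : G) :
    tensorPowAction ρ n g * tensorPowAction ρ n h = tensorPowAction ρ n (g * h) := by
  rw [tensorPowAction, Finset.sum_mul]
  refine Finset.sum_congr rfl fun a _ => ?_
  rw [ite_mul, zero_mul, tensorPowAction]
  split_ifs with ha
  -- Only the conjugate tuple g⁻¹ a g can be composed with `a`, and conjugation preserves degree 1.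
  · rw [Finset.mul_sum, Finset.sum_eq_single fun k => g⁻¹ * a k * g]
    · have h1 : (List.ofFn fun k => g⁻¹ * a k * g).prod = 1 := by
        have h2 : (List.ofFn fun k => g⁻¹ * a k * g) =
            (List.ofFn a).map (MulAut.conj g⁻¹) := by
          rw [List.map_ofFn]
          congr 1
          ext k
          simp
        rw [h2, ← map_list_prod, ha, map_one]
      rw [if_pos h1, piKronecker_mul]
      congr 1
      ext k : 1
      rw [← map_mul, single_mul_single, if_pos (by group)]
    · intro b _ hb
      obtain ⟨k, hk⟩ := Function.ne_iff.1 hb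
      rw [mul_ite, mul_zero, piKronecker_mul, piKronecker_eq_zero (k := k), ite_self]
      rw [← map_mul, single_mul_single, if_neg, map_zero]
      intro h'
      exact hk (by rw [h']; group)
    · simp
  · rfl

/-- Rotation permutes the tuples of labels, and the condition that the product is 1 is invariant
under rotation. -/
theorem rotationMatrix_mul_tensorPowAction (ρ : DrinfeldDouble G →ₐ[ℂ] Matrix ι ι ℂ) (n : ℕ)
    (g : G) : rotationMatrix ι ℂ n * tensorPowAction ρ n g =
      tensorPowAction ρ n g * rotationMatrix ι ℂ n := by
  rw [tensorPowAction, Finset.mul_sum, Finset.sum_mul]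
  refine Fintype.sum_equiv (Equiv.arrowCongr (finRotate n).symm (Equiv.refl G)) _ _ fun a => ?_
  have h1 : (Equiv.arrowCongr (finRotate n).symm (Equiv.refl G)) a = a ∘ finRotate n := rfl
  rw [h1, mul_ite, mul_zero, ite_mul, zero_mul, rotationMatrix_mul_piKronecker]
  simp only [prod_list_ofFn_comp_finRotate_eq_one_iff]
  rfl

/-- The projection to the invariants of the `n`-th tensor power of the representation `ρ`. -/
noncomputable def tensorPowInvariants (ρ : DrinfeldDouble G →ₐ[ℂ] Matrix ι ι ℂ) (n : ℕ) :
    Matrix (Fin n → ι) (Fin n → ι) ℂ :=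
  (Fintype.card G : ℂ)⁻¹ • ∑ g, tensorPowAction ρ n g

theorem isIdempotentElem_tensorPowInvariants (ρ : DrinfeldDouble G →ₐ[ℂ] Matrix ι ι ℂ) (n : ℕ) :
    IsIdempotentElem (tensorPowInvariants ρ n) := by
  have hG : (Fintype.card G : ℂ) ≠ 0 := by exact_mod_cast Fintype.card_ne_zero
  have h : ∀ g, tensorPowAction ρ n g * ∑ h, tensorPowAction ρ n h =
      ∑ h, tensorPowAction ρ n h := by
    intro g
    rw [Finset.mul_sum]
    exact Fintype.sum_equiv (Equiv.mulLeft g) _ _ fun h => tensorPowAction_mul ρ n g h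
  rw [IsIdempotentElem, tensorPowInvariants, smul_mul_smul_comm, Finset.sum_mul,
    Finset.sum_congr rfl fun g _ => h g, Finset.sum_const, Finset.card_univ,
    ← Nat.cast_smul_eq_nsmul ℂ, smul_smul]
  congr 1
  field_simp

theorem commute_tensorPowInvariants (ρ : DrinfeldDouble G →ₐ[ℂ] Matrix ι ι ℂ) (n : ℕ) :
    Commute (tensorPowInvariants ρ n) (rotationMatrix ι ℂ n) := by
  rw [Commute, SemiconjBy, tensorPowInvariants, smul_mul_assoc, mul_smul_comm, Finset.sum_mul,
    Finset.mul_sum]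
  congr 1
  exact Finset.sum_congr rfl fun g _ => (rotationMatrix_mul_tensorPowAction ρ n g).symm

theorem trace_tensorPowInvariants_mul (ρ : DrinfeldDouble G →ₐ[ℂ] Matrix ι ι ℂ) {n : ℕ}
    (hn : 0 < n) :
    (tensorPowInvariants ρ n * rotationMatrix ι ℂ n).trace =
      (ρ (sweedlerPow ℂ (DrinfeldDouble G) n (integral G))).trace := by
  rw [tensorPowInvariants, integral]
  simp only [map_smul, map_sum, smul_mul_assoc, Matrix.trace_smul, Finset.sum_mul,
    Matrix.trace_sum, sweedlerPow_single_eq_sum_list, tensorPowAction]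
  congr 1
  refine Finset.sum_congr rfl fun g _ => Finset.sum_congr rfl fun a _ => ?_
  split_ifs
  · rw [trace_piKronecker_mul_rotationMatrix hn, map_list_prod, List.map_ofFn]
    rfl
  · simp

theorem isIntegral_trace_sweedlerPow (ρ : DrinfeldDouble G →ₐ[ℂ] Matrix ι ι ℂ) {n : ℕ}
    (hn : 0 < n) :
    IsIntegral ℤ (ρ (sweedlerPow ℂ (DrinfeldDouble G) n (integral G))).trace := by
  rw [← trace_tensorPowInvariants_mul ρ hn]
  set T := tensorPowInvariants ρ n * rotationMatrix ι ℂ n with hT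
  -- An idempotent commuting with a rotation whose n-th power is 1.
  have hpow : T ^ (n + 1) = T := by
    rw [hT, (commute_tensorPowInvariants ρ n).mul_pow,
      (isIdempotentElem_tensorPowInvariants ρ n).pow_succ_eq, pow_succ, rotationMatrix_pow_self,
      one_mul]
  have h := isIntegral_trace_of_pow_succ_eq_self hn
    (a := Matrix.toLinAlgEquiv' T) (by rw [← map_pow, hpow])
  rwa [show (Matrix.toLinAlgEquiv' T) = Matrix.toLin' T from rfl, Matrix.trace_toLin'_eq] at h

/-- The Frobenius–Schur indicators are algebraic integers. -/
theorem isIntegral_fsIndicator {n : ℕ} (hn : 0 < n) (V : Type*) [AddCommGroup V] [Module ℂ V]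
    [Module (DrinfeldDouble G) V] [IsScalarTower ℂ (DrinfeldDouble G) V]
    [FiniteDimensional ℂ V] : IsIntegral ℤ (fsIndicator ℂ (integral G) n V) := by
  let b := Module.finBasis ℂ V
  let ρ : DrinfeldDouble G →ₐ[ℂ] Matrix _ _ ℂ :=
    (LinearMap.toMatrixAlgEquiv b).toAlgHom.comp (Algebra.lsmul ℂ ℂ V)
  have h := isIntegral_trace_sweedlerPow ρ hn
  have h2 : (ρ (sweedlerPow ℂ (DrinfeldDouble G) n (integral G))).trace =
      fsIndicator ℂ (integral G) n V :=
    (LinearMap.trace_eq_matrix_trace ℂ b _).symm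
  rwa [h2] at h

end DrinfeldDouble

/-! ### Semisimplicity of D(G) and separation of central elements by characters. -/

namespace DrinfeldDouble

variable {G : Type u} [Group G] [Fintype G] [DecidableEq G]

instance : FiniteDimensional ℂ (DrinfeldDouble G) :=
  inferInstanceAs (FiniteDimensional ℂ (G → G → ℂ))

/-- The diagonal entry at p_x ⊗ g is f(x,1), whatever `g` is. The resulting trace form is
nondegenerate, which makes the radical vanish. -/
theorem trace_mulLeft (f : DrinfeldDouble G) :
    LinearMap.trace ℂ (DrinfeldDouble G) (LinearMap.mulLeft ℂ f) =
      Fintype.card G * ∑ x, f x 1 := by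
  let e : DrinfeldDouble G ≃ₗ[ℂ] (G × G → ℂ) := (LinearEquiv.curry ℂ ℂ G G).symm
  let b : Module.Basis (G × G) ℂ (DrinfeldDouble G) := Module.Basis.ofEquivFun e
  have hb : ∀ x g, b (x, g) = single x g := by
    intro x g
    have : e (single x g) = Pi.single (x, g) 1 := by
      ext ⟨y, k⟩
      simp only [Pi.single_apply, Prod.mk.injEq]
      rfl
    rw [Module.Basis.coe_ofEquivFun]
    dsimp only
    rw [← this, LinearEquiv.symm_apply_apply]
  have hr : ∀ (f : DrinfeldDouble G) x g, b.repr f (x, g) = f x g := by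
    intro f x g
    rw [Module.Basis.ofEquivFun_repr_apply]
    rfl
  rw [LinearMap.trace_eq_matrix_trace ℂ b, Matrix.trace, Fintype.sum_prod_type, Finset.mul_sum]
  refine Finset.sum_congr rfl fun x _ => ?_
  simp only [Matrix.diag_apply, LinearMap.toMatrix_apply, hb, hr, LinearMap.mulLeft_apply]
  have h1 : ∀ g, (f * single x g) x g = f x 1 := by
    intro g
    rw [mul_apply, Finset.sum_eq_single 1]
    · simp [single_apply]
    · intro k _ hk
      simp [single_apply, hk]
    · simp
  simp [h1]

/-- `D(G)` has trivial Jacobson radical. -/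
theorem eq_zero_of_mem_jacobson {z : DrinfeldDouble G} (hz : z ∈ Ring.jacobson (DrinfeldDouble G)) :
    z = 0 := by
  have hG : (Fintype.card G : ℂ) ≠ 0 := by exact_mod_cast Fintype.card_ne_zero
  have : IsArtinianRing (DrinfeldDouble G) := IsArtinianRing.of_finite ℂ _
  obtain ⟨m, hm⟩ := IsSemiprimaryRing.isNilpotent (R := DrinfeldDouble G)
  have key : ∀ w : DrinfeldDouble G, ∑ x, (w * z) x 1 = 0 := by
    intro w
    have h1 : (w * z) ^ m = 0 := by
      have := Ideal.pow_mem_pow (Ideal.mul_mem_left _ w hz) m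
      rwa [hm] at this
    have h2 : IsNilpotent (LinearMap.mulLeft ℂ (w * z)) :=
      ⟨m, by rw [LinearMap.pow_mulLeft, h1, LinearMap.mulLeft_zero_eq_zero]⟩
    have h3 := (LinearMap.isNilpotent_trace_of_isNilpotent h2).eq_zero
    rw [trace_mulLeft] at h3
    exact (mul_eq_zero.1 h3).resolve_left hG
  ext x g
  -- This multiplier brings the coefficient of `z` at (x, g) to an entry at the identity and kills
  -- the other terms of the sum.
  have h := key (single (g⁻¹ * x * g) g⁻¹)
  rw [Finset.sum_eq_single (g⁻¹ * x * g), mul_apply, Finset.sum_eq_single g⁻¹] at h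
  · simpa [single_apply, mul_assoc] using h
  · intro k _ hk
    simp [single_apply, hk]
  · simp
  · intro y _ hy
    simp [mul_apply, single_apply, hy]
  · simp

/-- Class functions on commuting pairs are central elements of `D(G)`. -/
theorem commute_of_conj_invariant {f : DrinfeldDouble G}
    (hf : ∀ x g h, f (h * x * h⁻¹) (h * g * h⁻¹) = f x g)
    (hs : ∀ x g, ¬ Commute x g → f x g = 0) (w : DrinfeldDouble G) : Commute f w := by
  refine ext fun x g => ?_
  rw [mul_apply, mul_apply]
  refine Fintype.sum_equiv ((Equiv.inv G).trans (Equiv.mulRight g)) _ _ fun k => ?_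
  have hl : ((Equiv.inv G).trans (Equiv.mulRight g)) k = k⁻¹ * g := rfl
  rw [hl, mul_comm (f x k)]
  by_cases hk : Commute x k
  · have h1 : k⁻¹ * x * k = x := by rw [mul_assoc, hk.eq, inv_mul_cancel_left]
    have h2 := hf x k (k⁻¹ * g)⁻¹
    have h3 : (k⁻¹ * g)⁻¹ * k * (k⁻¹ * g)⁻¹⁻¹ = (k⁻¹ * g)⁻¹ * g := by group
    rw [h3, inv_inv] at h2
    rw [h1, h2]
  · have h2 := hf x k (k⁻¹ * g)⁻¹
    have h3 : (k⁻¹ * g)⁻¹ * k * (k⁻¹ * g)⁻¹⁻¹ = (k⁻¹ * g)⁻¹ * g := by group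
    rw [h3, inv_inv] at h2
    rw [h2, hs x k hk, mul_zero, mul_zero]

/-- A central element of `D(G)` at which all irreducible characters vanish is zero. -/
theorem eq_zero_of_forall_moduleCharacter_eq_zero {z : DrinfeldDouble G}
    (hc : ∀ w, Commute z w)
    (h : ∀ (V : Type u) [AddCommGroup V] [Module ℂ V] [Module (DrinfeldDouble G) V]
      [IsScalarTower ℂ (DrinfeldDouble G) V] [FiniteDimensional ℂ V]
      [IsSimpleModule (DrinfeldDouble G) V], moduleCharacter ℂ (DrinfeldDouble G) V z = 0) :
    z = 0 := by
  refine eq_zero_of_mem_jacobson ?_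
  rw [Ring.jacobson_eq_sInf_isMaximal, Ideal.mem_sInf]
  intro I hI
  have hsimple : IsSimpleModule (DrinfeldDouble G) (DrinfeldDouble G ⧸ I) :=
    isSimpleModule_iff_isCoatom.2 (Ideal.isMaximal_def.1 hI)
  have hfin : FiniteDimensional ℂ (DrinfeldDouble G ⧸ I) :=
    Module.Finite.of_surjective ((Submodule.mkQ I).restrictScalars ℂ) (Submodule.mkQ_surjective I)
  let φ : Module.End (DrinfeldDouble G) (DrinfeldDouble G ⧸ I) :=
    { toFun := fun v => z • v
      map_add' := smul_add z
      map_smul' := fun w v => by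
        rw [RingHom.id_apply, smul_smul, (hc w).eq, smul_smul] }
  -- By Schur, `z` acts as a scalar `c`; its trace c · dim is zero, so c = 0 and z = z · 1 lies in
  -- `I`.
  obtain ⟨c, hcφ⟩ := (IsSimpleModule.algebraMap_end_bijective_of_isAlgClosed ℂ
    (A := DrinfeldDouble G) (V := DrinfeldDouble G ⧸ I)).2 φ
  have hact : ∀ v : DrinfeldDouble G ⧸ I, z • v = c • v := fun v =>
    (LinearMap.congr_fun hcφ v).symm
  have htr := h (DrinfeldDouble G ⧸ I)
  have hend : (Algebra.lsmul ℂ ℂ (DrinfeldDouble G ⧸ I) z) =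
      c • (1 : Module.End ℂ (DrinfeldDouble G ⧸ I)) := LinearMap.ext hact
  rw [moduleCharacter, LinearMap.comp_apply, AlgHom.toLinearMap_apply, hend, map_smul,
    LinearMap.trace_one, smul_eq_mul, mul_eq_zero] at htr
  have : Nontrivial (DrinfeldDouble G ⧸ I) := IsSimpleModule.nontrivial (DrinfeldDouble G) _
  have hdim : (Module.finrank ℂ (DrinfeldDouble G ⧸ I) : ℂ) ≠ 0 := by
    exact_mod_cast Module.finrank_pos.ne'
  have hc0 := htr.resolve_right hdim
  have h1 := hact (Submodule.Quotient.mk 1)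
  rw [hc0, zero_smul, ← Submodule.Quotient.mk_smul, smul_eq_mul, mul_one,
    Submodule.Quotient.mk_eq_zero] at h1
  exact h1

/-! ### Galois twists of the indicator. -/

theorem single_pow_succ {a k : G} (h : Commute a k) (j : ℕ) :
    single a k ^ (j + 1) = single a (k ^ (j + 1)) := by
  induction j with
  | zero => simp
  | succ j ih =>
    rw [pow_succ, ih, single_mul_single, if_pos, ← pow_succ]
    rw [eq_mul_inv_iff_mul_eq]
    exact h.pow_right _

/-- The `j`-th Galois twist of `|G|` times the `n`-th indicator of `V`. -/
noncomputable def twistedIndicator (n : ℕ) (V : Type*) [AddCommGroup V] [Module ℂ V]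
    [Module (DrinfeldDouble G) V] [IsScalarTower ℂ (DrinfeldDouble G) V] (j : ℕ) : ℂ :=
  ∑ a : G, ∑ k : G, ((nthRootSet n a⁻¹ k⁻¹).ncard : ℂ) *
    moduleCharacter ℂ (DrinfeldDouble G) V (single a (k ^ j))

section Twist

variable (n : ℕ) (V : Type*) [AddCommGroup V] [Module ℂ V]
    [Module (DrinfeldDouble G) V] [IsScalarTower ℂ (DrinfeldDouble G) V]

theorem fsIndicator_eq_twistedIndicator_one :
    fsIndicator ℂ (integral G) n V = (Fintype.card G : ℂ)⁻¹ * twistedIndicator (G := G) n V 1 := by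
  simp only [fsIndicator_eq, twistedIndicator, pow_one]

open Polynomial in
-- For commuting a, k the element p_a ⊗ k satisfies x^(|G|+1) = x, so its traces come from an
-- integral polynomial; the other pairs have empty root sets. One polynomial for all `j` makes the
-- twists Galois conjugates.
theorem exists_polynomial_twistedIndicator [FiniteDimensional ℂ V] {ζ : ℂ}
    (hζ : IsPrimitiveRoot ζ (Fintype.card G)) :
    ∃ P : ℤ[X], ∀ j : ℕ, 0 < j → twistedIndicator (G := G) n V j = aeval (ζ ^ j) P := by
  have hQ : ∀ a k : G, ∃ Q : ℤ[X], ∀ j : ℕ, 0 < j →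
      ((nthRootSet n a⁻¹ k⁻¹).ncard : ℂ) *
        moduleCharacter ℂ (DrinfeldDouble G) V (single a (k ^ j)) = aeval (ζ ^ j) Q := by
    intro a k
    by_cases h : Commute a k
    · obtain ⟨Q, hQ⟩ := exists_polynomial_trace_pow (Fintype.card_pos (α := G))
        (a := Algebra.lsmul ℂ ℂ V (single a k))
        (by rw [← map_pow, single_pow_succ h, pow_succ, pow_card_eq_one, one_mul]) hζ
      refine ⟨C ((nthRootSet n a⁻¹ k⁻¹).ncard : ℤ) * Q, fun j hj => ?_⟩
      rw [map_mul, ← hQ j hj, ← map_pow]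
      obtain ⟨j, rfl⟩ := Nat.exists_eq_add_of_le' hj
      rw [single_pow_succ h]
      simp [moduleCharacter]
    · refine ⟨0, fun j _ => ?_⟩
      rw [nthRootSet_eq_empty_of_not_commute (by simpa using h)]
      simp
  choose Q hQ using hQ
  refine ⟨∑ a, ∑ k, Q a k, fun j hj => ?_⟩
  simp only [twistedIndicator, map_sum, hQ _ _ j hj]

/-- Reindexing by the bijection k ↦ k^i moves the twist from the characters to the counts, with
inverse exponent `j`. -/
theorem twistedIndicator_eq {i j : ℕ} (hij : ∀ k : G, k ^ (i * j) = k) :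
    twistedIndicator (G := G) n V i = ∑ a : G, ∑ k : G,
      ((nthRootSet n a⁻¹ (k ^ j)⁻¹).ncard : ℂ) *
        moduleCharacter ℂ (DrinfeldDouble G) V (single a k) := by
  let e : G ≃ G :=
    { toFun := fun k => k ^ i
      invFun := fun k => k ^ j
      left_inv := fun k => by dsimp only; rw [← pow_mul, hij]
      right_inv := fun k => by dsimp only; rw [← pow_mul, mul_comm, hij] }
  refine Finset.sum_congr rfl fun a _ => Fintype.sum_equiv e _ _ fun k => ?_
  have : e k = k ^ i := rfl
  rw [this, ← pow_mul, hij]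

end Twist

theorem exists_coprime_pow_mul_eq {j : ℕ} (hj : j.Coprime (Fintype.card G)) :
    ∃ i : ℕ, 0 < i ∧ i.Coprime (Fintype.card G) ∧ ∀ k : G, k ^ (i * j) = k := by
  set N := Fintype.card G with hN
  have hN0 : 0 < N := Fintype.card_pos
  refine ⟨j ^ (N.totient - 1), ?_, hj.pow_left _, fun k => ?_⟩
  -- j = 0 forces |G| = 1, where the exponent φ(1) − 1 is 0 and 0^0 = 1.
  · rcases Nat.eq_zero_or_pos j with rfl | h0
    · rw [Nat.coprime_zero_left] at hj
      simp [hj]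
    · positivity
  · rw [← pow_succ, Nat.sub_add_cancel (Nat.totient_pos.2 hN0)]
    have h1 : j ^ N.totient ≡ 1 [MOD orderOf k] :=
      (Nat.ModEq.pow_totient hj).of_dvd orderOf_dvd_card
    rw [pow_eq_pow_iff_modEq.2 h1, pow_one]

theorem exists_coprime_zpow_eq_pow {m : ℤ} (hm : Int.gcd m (Fintype.card G) = 1) :
    ∃ j : ℕ, j.Coprime (Fintype.card G) ∧ ∀ g : G, g ^ m = g ^ j := by
  have hN0 : (Fintype.card G : ℤ) ≠ 0 := by exact_mod_cast Fintype.card_ne_zero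
  obtain ⟨j, hj⟩ := Int.eq_ofNat_of_zero_le (Int.emod_nonneg m hN0)
  refine ⟨j, ?_, fun g => ?_⟩
  · rw [← Int.gcd_emod, hj] at hm
    exact hm
  · rw [← zpow_natCast, ← hj, zpow_mod_card]

end DrinfeldDouble

/-! ### The characterization of FSZ_n-groups. -/

theorem exists_int_eq_of_isIntegral_of_eq_div {x : ℂ} (hx : IsIntegral ℤ x) {c N : ℤ}
    (h : x = c / N) : ∃ z : ℤ, x = z := by
  have h1 : x = algebraMap ℚ ℂ (c / N : ℚ) := by simp [h]
  rw [h1, isIntegral_algebraMap_iff (algebraMap ℚ ℂ).injective] at hx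
  obtain ⟨z, hz⟩ := IsIntegrallyClosed.isIntegral_iff.1 hx
  exact ⟨z, by rw [h1, ← hz]; simp⟩

open DrinfeldDouble

theorem mainTheorem2 {G : Type*} [Group G] [Fintype G] [DecidableEq G] (n : ℕ) (hn : 0 < n) :
    IsFSZ G n ↔
      ∀ u g : G, Commute u g → ∀ m : ℤ, Int.gcd m (Fintype.card G) = 1 →
        (nthRootSet n u g).ncard = (nthRootSet n u (g ^ m)).ncard := by
  have hN : 0 < Fintype.card G := Fintype.card_pos
  have hN0 : (Fintype.card G : ℂ) ≠ 0 := by exact_mod_cast hN.ne'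
  have hζ := Complex.isPrimitiveRoot_exp (Fintype.card G) hN.ne'
  constructor
  · intro h u g _ m hm
    obtain ⟨j, hj, hmj⟩ := exists_coprime_zpow_eq_pow hm
    obtain ⟨i, hi0, hi, hij⟩ := exists_coprime_pow_mul_eq hj
    let z : DrinfeldDouble G := fun a k =>
      ((nthRootSet n a⁻¹ (k ^ j)⁻¹).ncard : ℂ) - (nthRootSet n a⁻¹ k⁻¹).ncard
    have hz : z = 0 := by
      refine eq_zero_of_forall_moduleCharacter_eq_zero (commute_of_conj_invariant ?_ ?_) ?_
      · intro x g h
        have h1 : (h * x * h⁻¹)⁻¹ = h * x⁻¹ * h⁻¹ := by group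
        have h2 : ∀ g : G, (h * g * h⁻¹)⁻¹ = h * g⁻¹ * h⁻¹ := fun g => by group
        simp only [z, conj_pow, h1, h2, ncard_nthRootSet_conj]
      · intro x g hxg
        have h1 : ¬ Commute x (g ^ j) := by
          intro h'
          have h2 := h'.pow_right i
          rw [← pow_mul, mul_comm, hij] at h2
          exact hxg h2
        simp only [z]
        rw [nthRootSet_eq_empty_of_not_commute (by simpa using h1),
          nthRootSet_eq_empty_of_not_commute (by simpa using hxg), sub_self]
      · intro V _ _ _ _ _ _
        obtain ⟨c, hc⟩ := h V
        obtain ⟨P, hP⟩ := exists_polynomial_twistedIndicator n V hζ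
        rw [fsIndicator_eq_twistedIndicator_one, inv_mul_eq_iff_eq_mul₀ hN0] at hc
        have hval : Polynomial.aeval (Complex.exp (2 * Real.pi * Complex.I / Fintype.card G)) P =
            ((Fintype.card G * c : ℤ) : ℂ) := by
          rw [← pow_one (Complex.exp _), ← hP 1 one_pos, hc]
          simp
        -- The integer |G|ν_n(V) equals its own twist by `i`, that is, the sum with counts twisted
        -- by `j`; so the character vanishes at `z`.
        have h1 := aeval_pow_eq_of_aeval_eq_intCast hN hζ hval hi
        rw [← hP i hi0, twistedIndicator_eq n V hij] at h1
        have h2 : twistedIndicator (G := G) n V 1 = ((Fintype.card G * c : ℤ) : ℂ) := by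
          rw [hc]; simp
        rw [twistedIndicator] at h2
        simp only [pow_one] at h2
        rw [eq_sum_single z]
        simp only [map_sum, map_smul, smul_eq_mul, z, sub_mul, Finset.sum_sub_distrib, h1, h2,
          sub_self]
    have h1 : z u⁻¹ g⁻¹ = 0 := by rw [hz]; rfl
    simp only [z, inv_inv, inv_pow, sub_eq_zero] at h1
    rw [hmj]
    exact_mod_cast h1.symm
  · intro h V _ _ _ _ _ _
    obtain ⟨P, hP⟩ := exists_polynomial_twistedIndicator n V hζ
    have hconst : ∀ i : ℕ, 0 < i → i.Coprime (Fintype.card G) →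
        twistedIndicator (G := G) n V i = twistedIndicator (G := G) n V 1 := by
      intro i _ hi
      obtain ⟨j, _, hj, hij⟩ := exists_coprime_pow_mul_eq hi
      rw [twistedIndicator_eq n V (fun k => by rw [mul_comm, hij k]), twistedIndicator]
      refine Finset.sum_congr rfl fun a _ => Finset.sum_congr rfl fun k _ => ?_
      rw [pow_one]
      by_cases hak : Commute a k
      · have h1 := h a⁻¹ k⁻¹ (by simpa using hak) j (by simpa using hj)
        rw [zpow_natCast, inv_pow] at h1
        rw [h1]
      · rw [moduleCharacter_single_eq_zero V hak, mul_zero, mul_zero]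
    obtain ⟨c, hc⟩ := exists_int_aeval_eq_of_forall_pow hN hζ (P := P) (by
      intro i hi0 hi
      rw [← hP i hi0, hconst i hi0 hi, hP 1 one_pos, pow_one])
    -- Galois invariance only gives ν_n(V) = c/|G|; integrality removes the denominator.
    refine exists_int_eq_of_isIntegral_of_eq_div (isIntegral_fsIndicator hn V)
      (c := c) (N := Fintype.card G) ?_
    rw [fsIndicator_eq_twistedIndicator_one, hP 1 one_pos, pow_one, hc, div_eq_inv_mul]
    simp
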